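/- Let $k\ge 2$. A $k$-hypergraph is a $k$-uniform hypergraph $G$ with vertex set $[n]=\{1,\dots,n\}$; $e(G)$ denotes its number of edges. Its independence oracle is the bit string $\mathrm{IND}(G)$ indexed by the sets $S\subseteq[n]$, with $\mathrm{IND}(G)_S=1$ if the induced subgraph $G[S]$ contains no edge, and $\mathrm{IND}(G)_S=0$ otherwise. A deterministic independence-oracle algorithm knows $n$ and $k$, accesses $G$ only by querying bits of $\mathrm{IND}(G)$ (each query may depend on the answers to the earlier ones), and after finitely many queries outputs a real number. A randomised independence-oracle algorithm $\mathcal A$ is, for each $n$ and $k$, a discrete probability distribution over deterministic ones. For every $k\ge2$ let $\alpha_k\in[0,k]$. A query to a set $S\ne\emptyset$ costs $|S|^{\alpha_k}$ and a query to the empty set costs $0$; the oracle cost $\mathrm{cost}(A,G)$ of a deterministic algorithm $A$ on $G$ is the sum of the costs of the queries that it makes when it is run on $\mathrm{IND}(G)$. The worst-case expected oracle cost of $\mathcal A$ at $(n,k)$ is $\max_G \mathbb E_{A\sim\mathcal A}[\mathrm{cost}(A,G)]$, where the maximum is over all $n$-vertex $k$-hypergraphs $G$. For real $x$ write $\lfloor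 x\rceil=\lfloor x+1/2\rfloor$, and let $$g(k,\beta)=\frac1k\Big\lfloor\frac{k-\beta}2\Big\rceil\Big(k-\beta-\Big\lfloor\frac{k-\beta}2\Big\rceil\Big).$$ **Theorem.** There are absolute constants $c>0$ and $n_0$ such that the following holds for all integers $n\ge n_0$ and all integers $k$ with $2\le k\le n$ (so $k$ may depend on $n$ in an arbitrary fashion), and for every $\alpha_k\in[0,k]$. Let $\mathcal A$ be a randomised independence-oracle algorithm such that, for every $n$-vertex $k$-hypergraph $G$, the output $x$ of $\mathcal A$ on $\mathrm{IND}(G)$ satisfies $|x-e(G)|\le\tfrac12 e(G)$ with probability at least $9/10$. Then the worst-case expected oracle cost of $\mathcal A$ at $(n,k)$ is at least $$c\cdot\frac{n^{\alpha_k+g(k,\alpha_k)}}{k^{3k}}.$$ -/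

import Mathlib

/-- A `k`-uniform hypergraph on the vertex set `Fin n` (the `n` vertices of `[n]`). -/
structure KHypergraph (n k : ℕ) where
  /-- the edge set -/
  edges : Finset (Finset (Fin n))
  /-- every edge has exactly `k` vertices -/
  uniform : ∀ e ∈ edges, e.card = k

/-- The number of edges `e(G)`. -/
def KHypergraph.edgeCount {n k : ℕ} (G : KHypergraph n k) : ℕ :=
  G.edges.card

/-- The (uncoloured) independence oracle of `G`: the bit at `S` is `1` (`true`) if the induced
subgraph `G[S]` contains no edge, and `0` (`false`) otherwise. -/
def KHypergraph.indOracle {n k : ℕ} (G : KHypergraph n k) (S : Finset (Fin n)) : Bool :=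
  decide (∀ e ∈ G.edges, ¬ e ⊆ S)

/-- A deterministic algorithm for an oracle indexed by the subsets of `Fin n`. It either stops with
a real output, or queries a set `S` and continues in a way that depends on the bit it receives.
The values of `n` and `k` are known to the algorithm: an algorithm that receives `n` and `k` as
inputs is a family of such objects, one for each pair `(n, k)`. There is no restriction at all on
the computation between two queries. -/
inductive OracleAlg (n : ℕ) : Type
  | output (x : ℝ) : OracleAlg n
  | query (S : Finset (Fin n)) (next : Bool → OracleAlg n) : OracleAlg n

/-- The output of a deterministic oracle algorithm run with the oracle `O`. -/
def OracleAlg.run {n : ℕ} (O : Finset (Fin n) → Bool) : OracleAlg n → ℝ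
  | .output x => x
  | .query S next => (next (O S)).run O

/-- The sequence of queries that a deterministic oracle algorithm makes with the oracle `O`. -/
def OracleAlg.queries {n : ℕ} (O : Finset (Fin n) → Bool) : OracleAlg n → List (Finset (Fin n))
  | .output _ => []
  | .query S next => S :: (next (O S)).queries O

/-- The cost `x ^ β` of a query to a set of size `x`, where empty queries are free (also for
`β = 0`). -/
noncomputable def queryCost (β : ℝ) (x : ℕ) : ℝ :=
  if x = 0 then 0 else (x : ℝ) ^ β

/-- The oracle cost of a deterministic algorithm on the input `G`: the sum of the costs of the
queries that it makes with the independence oracle of `G`. -/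
noncomputable def OracleAlg.cost {n k : ℕ} (β : ℝ) (A : OracleAlg n) (G : KHypergraph n k) : ℝ :=
  ((A.queries G.indOracle).map (fun S => queryCost β S.card)).sum

/-- A randomised oracle algorithm (for given `n` and `k`) is a discrete probability distribution
over deterministic oracle algorithms. -/
abbrev RandomisedOracleAlg (n : ℕ) : Type :=
  PMF (OracleAlg n)

/-- The expected oracle cost of a randomised algorithm on the input `G`; it may be infinite. -/
noncomputable def RandomisedOracleAlg.expectedCost {n k : ℕ} (β : ℝ) (𝒜 : RandomisedOracleAlg n)
    (G : KHypergraph n k) : ENNReal :=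
  ∑' A : OracleAlg n, 𝒜 A * ENNReal.ofReal (A.cost β G)

/-- The worst-case expected oracle cost: the maximum of the expected oracle cost over all
`k`-uniform hypergraphs on `n` vertices. -/
noncomputable def RandomisedOracleAlg.worstCaseExpectedCost {n : ℕ} (k : ℕ) (β : ℝ)
    (𝒜 : RandomisedOracleAlg n) : ENNReal :=
  ⨆ G : KHypergraph n k, RandomisedOracleAlg.expectedCost β 𝒜 G

/-- `x` is an `ε`-approximation to `y`. -/
def IsApproximation (ε x y : ℝ) : Prop :=
  |x - y| ≤ ε * y

/-- The probability that the output of `𝒜` on the independence oracle of `G` is an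
`ε`-approximation to the number of edges of `G`. -/
noncomputable def RandomisedOracleAlg.successProb {n k : ℕ} (ε : ℝ) (𝒜 : RandomisedOracleAlg n)
    (G : KHypergraph n k) : ENNReal :=
  𝒜.toOuterMeasure {A | IsApproximation ε (A.run G.indOracle) G.edgeCount}

/-- Rounding to the nearest integer, rounding up in case of a tie. -/
noncomputable def roundHalfUp (x : ℝ) : ℤ :=
  ⌊x + 1 / 2⌋

/-- The overhead exponent
`g(k, β) = (1 / k) * ⌊(k - β) / 2⌉ * (k - β - ⌊(k - β) / 2⌉)`. -/
noncomputable def overheadExponent (k β : ℝ) : ℝ :=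
  1 / k * (roundHalfUp ((k - β) / 2) : ℝ) * (k - β - (roundHalfUp ((k - β) / 2) : ℝ))

/-!
The proof plants edges in a sparse random hypergraph.  Put `r = k - ⌊(k - α) / 2⌉`, so that `α ≤ r`
and `α + g(k, α) = r (k - r + α) / k`.  Let `G` keep every `k`-set independently with probability
`p = C(k, r) / (8 C(n, r))`, and let `G'` be `G` together with all `k`-sets that contain a uniformly
random `r`-set `R`.  There are `C(n - r, k - r)` planted sets, eight times the expected number of
edges of `G`, so with probability at least `1/2` the hypergraph `G'` has at least four times as many
edges as `G`, and no number approximates both edge counts.  An accurate algorithm must then query,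
when run on `G`, a set `S` of size at least `k` that is independent in `G` and contains `R`
(`OracleAlg.mem_coveredSets_of_isApproximation`).

The number of such `R` is bounded by following the family of `k`-sets that the algorithm has
certified to be non-edges.  Call an `r`-set covered if it lies in one of them.  Suppose that a query
`S` of size `s` would cover `δ` new `r`-sets if it turned out to be independent, and that `t` of the
`k`-subsets of `S` are not yet certified.  Given the history, `S` is independent with probability
at most `(1 - p) ^ t`: positive answers concern other `k`-sets only, and negative ones make edges
more likely (`sum_bernoulliWeight_disjoint_le`).  No certified `k`-set contains a new `r`-set, so
double counting gives `δ C(s - r, k - r) ≤ t C(k, r)` (`card_new_covered_mul_le`).  Since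
`(1 - p) ^ t p t ≤ 1`, the expected gain is at most `8 C(n, r) / C(s - r, k - r)`; it is also at
most `C(s, r)`.  These two bounds cross at `s = n ^ (r / k)`, and on both sides the gain is at most
`C(n, r) · 8 k ^ k · s ^ α / n ^ (r (k - r + α) / k)` (`expected_gain_le_charge`).  Summing over the
decision tree (`sum_covered_le_sum_charge`) bounds the expected number of covered `r`-sets by a
multiple of the expected cost, while accuracy forces it to be at least `2/5 · C(n, r)`.  This proves
the bound with `k ^ k` in place of `k ^ (3 k)`, for all `n` and with `c = 1/20`.
-/

open Finset

/-! ### Random subsets of a finite set -/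

section Weights

variable {ι : Type*}

/-- The probability of drawing exactly `E` when every element of the finite ground set `Ω` is kept
independently with probability `p`. It is only used for `E ⊆ Ω`. -/
def bernoulliWeight (p : ℝ) (Ω E : Finset ι) : ℝ :=
  p ^ #E * (1 - p) ^ (#Ω - #E)

theorem bernoulliWeight_nonneg {p : ℝ} (hp0 : 0 ≤ p) (hp1 : p ≤ 1) (Ω E : Finset ι) :
    0 ≤ bernoulliWeight p Ω E :=
  mul_nonneg (pow_nonneg hp0 _) (pow_nonneg (sub_nonneg.2 hp1) _)

theorem sum_bernoulliWeight (p : ℝ) (Ω : Finset ι) :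
    ∑ E ∈ Ω.powerset, bernoulliWeight p Ω E = 1 := by
  have h := Finset.sum_pow_mul_eq_add_pow p (1 - p) Ω
  simpa [bernoulliWeight] using h

variable [DecidableEq ι]

theorem bernoulliWeight_insert (p : ℝ) {Ω E : Finset ι} (hE : E ⊆ Ω) {e : ι} (he : e ∈ Ω)
    (heE : e ∉ E) :
    (1 - p) * bernoulliWeight p Ω (insert e E) = p * bernoulliWeight p Ω E := by
  have hlt : #E < #Ω := card_lt_card ⟨hE, fun h => heE (h he)⟩
  obtain ⟨d, hd⟩ := Nat.exists_eq_add_of_lt hlt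
  have h1 : #Ω - (#E + 1) = d := by omega
  have h2 : #Ω - #E = d + 1 := by omega
  rw [bernoulliWeight, bernoulliWeight, card_insert_of_notMem heE, h1, h2]
  ring

/-- An elementary instance of the Harris inequality: on a class of sets that is closed under
inserting `e`, conditioning on the class can only make `e` more likely to be present. -/
theorem sum_bernoulliWeight_notMem_le {p : ℝ} (hp0 : 0 ≤ p) (hp1 : p ≤ 1) {Ω : Finset ι}
    {V : Finset (Finset ι)} (hV : V ⊆ Ω.powerset) {e : ι} (he : e ∈ Ω)
    (hins : ∀ E ∈ V, insert e E ∈ V) :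
    ∑ E ∈ V with e ∉ E, bernoulliWeight p Ω E ≤ (1 - p) * ∑ E ∈ V, bernoulliWeight p Ω E := by
  have hinj : Set.InjOn (insert e) (V.filter (e ∉ ·) : Set (Finset ι)) := by
    intro A hA B hB hAB
    simp only [coe_filter, Set.mem_ofPred_eq] at hA hB
    rw [← erase_insert hA.2, ← erase_insert hB.2, hAB]
  have hle : ∑ E ∈ V with e ∉ E, bernoulliWeight p Ω (insert e E)
      ≤ ∑ E ∈ V with ¬ e ∉ E, bernoulliWeight p Ω E := by
    rw [← sum_image (f := bernoulliWeight p Ω) hinj]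
    refine sum_le_sum_of_subset_of_nonneg ?_ fun _ _ _ => bernoulliWeight_nonneg hp0 hp1 _ _
    intro B hB
    obtain ⟨A, hA, rfl⟩ := mem_image.1 hB
    simpa using hins A (mem_filter.1 hA).1
  have heq : (1 - p) * ∑ E ∈ V with e ∉ E, bernoulliWeight p Ω (insert e E)
      = p * ∑ E ∈ V with e ∉ E, bernoulliWeight p Ω E := by
    rw [mul_sum, mul_sum]
    refine sum_congr rfl fun E hE => ?_
    rw [mem_filter] at hE
    exact bernoulliWeight_insert p (mem_powerset.1 (hV hE.1)) he hE.2
  have hsplit := sum_filter_add_sum_filter_not V (e ∉ ·) (bernoulliWeight p Ω)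
  have := mul_le_mul_of_nonneg_left hle (sub_nonneg.2 hp1)
  rw [← hsplit]
  linarith

/-- Conditioning on a class of sets that is closed under inserting elements of `T` does not make it
more likely that a random set avoids `T`. -/
theorem sum_bernoulliWeight_disjoint_le {p : ℝ} (hp0 : 0 ≤ p) (hp1 : p ≤ 1) {Ω : Finset ι}
    {V : Finset (Finset ι)} (hV : V ⊆ Ω.powerset) (T : Finset ι) (hT : T ⊆ Ω)
    (hins : ∀ E ∈ V, ∀ e ∈ T, insert e E ∈ V) :
    ∑ E ∈ V with Disjoint T E, bernoulliWeight p Ω E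
      ≤ (1 - p) ^ #T * ∑ E ∈ V, bernoulliWeight p Ω E := by
  induction T using Finset.induction_on with
  | empty => simp
  | insert e T heT ih =>
    have ih' := ih (fun x hx => hT (mem_insert_of_mem hx))
      (fun E hE x hx => hins E hE x (mem_insert_of_mem hx))
    have hstep := sum_bernoulliWeight_notMem_le hp0 hp1
      (V := V.filter (Disjoint T ·)) ((filter_subset _ _).trans hV)
      (hT (mem_insert_self e T)) (by
        intro E hE
        rw [mem_filter] at hE ⊢
        refine ⟨hins E hE.1 e (mem_insert_self e T), ?_⟩
        rw [disjoint_insert_right]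
        exact ⟨heT, hE.2⟩)
    rw [filter_filter] at hstep
    have hfil : V.filter (Disjoint (insert e T) ·)
        = V.filter (fun E => Disjoint T E ∧ e ∉ E) := by
      refine filter_congr fun E _ => ?_
      rw [disjoint_insert_left, and_comm]
    rw [hfil, card_insert_of_notMem heT]
    calc _ ≤ _ := hstep
      _ ≤ (1 - p) * ((1 - p) ^ #T * ∑ E ∈ V, bernoulliWeight p Ω E) :=
        mul_le_mul_of_nonneg_left ih' (sub_nonneg.2 hp1)
      _ = _ := by ring

theorem sum_bernoulliWeight_mem_le {p : ℝ} (hp0 : 0 ≤ p) (hp1 : p ≤ 1) {Ω : Finset ι} {e : ι}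
    (he : e ∈ Ω) :
    ∑ E ∈ Ω.powerset with e ∈ E, bernoulliWeight p Ω E ≤ p := by
  have hinj : Set.InjOn (fun E : Finset ι => E.erase e)
      (Ω.powerset.filter (e ∈ ·) : Set (Finset ι)) := by
    intro A hA B hB hAB
    simp only [coe_filter, Set.mem_ofPred_eq] at hA hB
    rw [← insert_erase hA.2, ← insert_erase hB.2]
    exact congrArg _ hAB
  have hle : ∑ E ∈ Ω.powerset with e ∈ E, bernoulliWeight p Ω (E.erase e)
      ≤ ∑ E ∈ Ω.powerset with ¬ e ∈ E, bernoulliWeight p Ω E := by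
    rw [← sum_image (f := bernoulliWeight p Ω) hinj]
    refine sum_le_sum_of_subset_of_nonneg ?_ fun _ _ _ => bernoulliWeight_nonneg hp0 hp1 _ _
    intro B hB
    obtain ⟨A, hA, rfl⟩ := mem_image.1 hB
    rw [mem_filter, mem_powerset] at hA ⊢
    exact ⟨(erase_subset _ _).trans hA.1, notMem_erase _ _⟩
  have heq : (1 - p) * ∑ E ∈ Ω.powerset with e ∈ E, bernoulliWeight p Ω E
      = p * ∑ E ∈ Ω.powerset with e ∈ E, bernoulliWeight p Ω (E.erase e) := by
    rw [mul_sum, mul_sum]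
    refine sum_congr rfl fun E hE => ?_
    rw [mem_filter, mem_powerset] at hE
    rw [← bernoulliWeight_insert p ((erase_subset _ _).trans hE.1) he (notMem_erase _ _),
      insert_erase hE.2]
  have hsplit := sum_filter_add_sum_filter_not Ω.powerset (e ∈ ·) (bernoulliWeight p Ω)
  rw [sum_bernoulliWeight] at hsplit
  have := mul_le_mul_of_nonneg_left hle hp0
  nlinarith

theorem sum_bernoulliWeight_mul_card_le {p : ℝ} (hp0 : 0 ≤ p) (hp1 : p ≤ 1) (Ω : Finset ι) :
    ∑ E ∈ Ω.powerset, bernoulliWeight p Ω E * #E ≤ p * #Ω := by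
  have hcard : ∀ E ∈ Ω.powerset, bernoulliWeight p Ω E * (#E : ℝ)
      = ∑ e ∈ Ω, if e ∈ E then bernoulliWeight p Ω E else 0 := by
    intro E hE
    rw [← sum_filter, sum_const, filter_mem_eq_inter,
      inter_eq_right.2 (mem_powerset.1 hE), nsmul_eq_mul, mul_comm]
  rw [sum_congr rfl hcard, sum_comm]
  calc _ ≤ ∑ _e ∈ Ω, p := by
        refine sum_le_sum fun e he => ?_
        rw [← sum_filter]
        exact sum_bernoulliWeight_mem_le hp0 hp1 he
    _ = p * #Ω := by rw [sum_const, nsmul_eq_mul, mul_comm]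

/-- Markov's inequality for the size of a random subset. -/
theorem half_le_sum_bernoulliWeight_card_le {p K : ℝ} (hp0 : 0 ≤ p) (hp1 : p ≤ 1) (hK : 0 < K)
    (Ω : Finset ι) (hmean : 8 * (p * #Ω) ≤ K) :
    1 / 2 ≤ ∑ E ∈ Ω.powerset with 4 * (#E : ℝ) ≤ K, bernoulliWeight p Ω E := by
  have hsplit := sum_filter_add_sum_filter_not Ω.powerset
    (fun E => 4 * (#E : ℝ) ≤ K) (bernoulliWeight p Ω)
  rw [sum_bernoulliWeight] at hsplit
  have hbad : K * ∑ E ∈ Ω.powerset with ¬ 4 * (#E : ℝ) ≤ K, bernoulliWeight p Ω E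
      ≤ 4 * ∑ E ∈ Ω.powerset, bernoulliWeight p Ω E * #E := by
    rw [mul_sum, mul_sum]
    calc _ ≤ ∑ E ∈ Ω.powerset with ¬ 4 * (#E : ℝ) ≤ K, 4 * (bernoulliWeight p Ω E * #E) := by
          refine sum_le_sum fun E hE => ?_
          have h := (mem_filter.1 hE).2
          nlinarith [bernoulliWeight_nonneg hp0 hp1 Ω E]
      _ ≤ _ := sum_le_sum_of_subset_of_nonneg (filter_subset _ _) fun E _ _ => by
          have := bernoulliWeight_nonneg hp0 hp1 Ω E
          positivity
  have := sum_bernoulliWeight_mul_card_le hp0 hp1 Ω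
  by_contra! h
  nlinarith

end Weights

/-! ### Binomial estimates -/

section Counting

variable {γ : Type*} [DecidableEq γ]

theorem card_powersetCard_filter_subset {R S : Finset γ} (hRS : R ⊆ S) {k : ℕ} (hk : #R ≤ k) :
    #{e ∈ powersetCard k S | R ⊆ e} = (#S - #R).choose (k - #R) := by
  rw [← card_sdiff_of_subset hRS, ← card_powersetCard]
  refine card_bij' (fun e _ => e \ R) (fun f _ => f ∪ R) ?_ ?_ ?_ ?_
  · intro e he
    rw [mem_filter, mem_powersetCard] at he
    rw [mem_powersetCard]
    exact ⟨sdiff_subset_sdiff he.1.1 Subset.rfl, by rw [card_sdiff_of_subset he.2, he.1.2]⟩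
  · intro f hf
    rw [mem_powersetCard] at hf
    have hdis : Disjoint f R := disjoint_of_subset_left hf.1 sdiff_disjoint
    rw [mem_filter, mem_powersetCard]
    refine ⟨⟨union_subset (hf.1.trans sdiff_subset) hRS, ?_⟩, subset_union_right⟩
    rw [card_union_of_disjoint hdis, hf.2]
    omega
  · intro e he
    exact sdiff_union_of_subset (mem_filter.1 he).2
  · intro f hf
    rw [mem_powersetCard] at hf
    have hdis : Disjoint f R := disjoint_of_subset_left hf.1 sdiff_disjoint
    exact union_sdiff_cancel_right hdis

/-- A random `r`-set lies in a given `s`-set with probability at most `(s / n) ^ r`. -/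
theorem choose_mul_pow_le {s n : ℕ} (h : s ≤ n) (r : ℕ) :
    s.choose r * n ^ r ≤ n.choose r * s ^ r := by
  induction r with
  | zero => simp
  | succ r ih =>
    refine Nat.le_of_mul_le_mul_right (c := r + 1) ?_ (Nat.succ_pos r)
    have h1 : (s - r) * n ≤ (n - r) * s := by
      rw [Nat.sub_mul, Nat.sub_mul, mul_comm n s]
      exact Nat.sub_le_sub_left (Nat.mul_le_mul_left r h) _
    calc s.choose (r + 1) * n ^ (r + 1) * (r + 1)
        = (s.choose (r + 1) * (r + 1)) * n ^ (r + 1) := by ring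
      _ = (s.choose r * n ^ r) * ((s - r) * n) := by rw [Nat.choose_succ_right_eq]; ring
      _ ≤ (n.choose r * s ^ r) * ((n - r) * s) := Nat.mul_le_mul ih h1
      _ = (n.choose (r + 1) * (r + 1)) * s ^ (r + 1) := by rw [Nat.choose_succ_right_eq]; ring
      _ = _ := by ring

/-- For `r ≤ k` this is the estimate `(s / k) ^ (k - r) ≤ C(s - r, k - r)`. -/
theorem pow_le_pow_mul_choose_sub (r : ℕ) {k s : ℕ} (hks : k ≤ s) :
    s ^ (k - r) ≤ k ^ (k - r) * (s - r).choose (k - r) := by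
  rcases Nat.eq_zero_or_pos (k - r) with h0 | hpos
  · simp [h0]
  refine Nat.le_of_mul_le_mul_right (c := (k - r) ^ (k - r)) ?_ (pow_pos hpos _)
  have h1 : s * (k - r) ≤ k * (s - r) := by
    rw [Nat.mul_sub, Nat.mul_sub, mul_comm s k]
    exact Nat.sub_le_sub_left (Nat.mul_le_mul_right r hks) _
  have h2 := choose_mul_pow_le (Nat.sub_le_sub_right hks r) (k - r)
  rw [Nat.choose_self, one_mul] at h2
  calc s ^ (k - r) * (k - r) ^ (k - r) = (s * (k - r)) ^ (k - r) := (mul_pow _ _ _).symm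
    _ ≤ (k * (s - r)) ^ (k - r) := Nat.pow_le_pow_left h1 _
    _ = k ^ (k - r) * (s - r) ^ (k - r) := mul_pow _ _ _
    _ ≤ k ^ (k - r) * ((s - r).choose (k - r) * (k - r) ^ (k - r)) := Nat.mul_le_mul_left _ h2
    _ = _ := by ring

end Counting

/-! ### Covered sets along a decision tree -/

section Search

variable {n : ℕ}

/-- The independence oracle of the hypergraph whose edge set is `E`. -/
def familyOracle (E : Finset (Finset (Fin n))) (S : Finset (Fin n)) : Bool :=
  decide (∀ e ∈ E, ¬ e ⊆ S)

/-- The `r`-sets that are contained in some member of `F`. -/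
def coveredSets (r : ℕ) (F : Finset (Finset (Fin n))) : Finset (Finset (Fin n)) :=
  {R ∈ powersetCard r univ | ∃ e ∈ F, R ⊆ e}

theorem coveredSets_mono (r : ℕ) {F F' : Finset (Finset (Fin n))} (h : F ⊆ F') :
    coveredSets r F ⊆ coveredSets r F' := by
  intro R hR
  rw [coveredSets, mem_filter] at hR ⊢
  obtain ⟨hR, e, he, hRe⟩ := hR
  exact ⟨hR, e, h he, hRe⟩

/-- The `k`-sets that the algorithm `A` has certified to be non-edges when it stops: the `k`-subsets
of those queried sets that turned out to be independent. -/
def OracleAlg.certifiedNonEdges (k : ℕ) (O : Finset (Fin n) → Bool) :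
    OracleAlg n → Finset (Finset (Fin n))
  | .output _ => ∅
  | .query S next =>
      (if O S then powersetCard k S else ∅) ∪ (next (O S)).certifiedNonEdges k O

/-- The expected number of `r`-sets that get covered by certified non-edges is at most the expected
total charge, provided the charge `q S` pays for the expected gain of a single query to `S`.
In the induction over the decision tree, `F` is the set of `k`-sets already certified to be
non-edges and `V` is the set of hypergraphs that agree with the answers so far: it is closed under
adding edges outside `F`, so the answers "not independent" do not make independence of the next
query more likely. -/
theorem sum_covered_le_sum_charge {k r : ℕ} {p : ℝ} (hp0 : 0 ≤ p) (hp1 : p ≤ 1)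
    (q : Finset (Fin n) → ℝ)
    (hstep : ∀ S F, (1 - p) ^ #(powersetCard k S \ F) *
      ((#(coveredSets r (F ∪ powersetCard k S)) : ℝ) - #(coveredSets r F)) ≤ q S)
    (A : OracleAlg n) (F : Finset (Finset (Fin n))) (V : Finset (Finset (Finset (Fin n))))
    (hV : V ⊆ (powersetCard k univ).powerset)
    (hins : ∀ E ∈ V, ∀ e ∈ powersetCard k univ, e ∉ F → insert e E ∈ V) :
    ∑ E ∈ V, bernoulliWeight p (powersetCard k univ) E *
        ((#(coveredSets r (F ∪ A.certifiedNonEdges k (familyOracle E))) : ℝ)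
          - #(coveredSets r F))
      ≤ ∑ E ∈ V, bernoulliWeight p (powersetCard k univ) E *
        ((A.queries (familyOracle E)).map q).sum := by
  induction A generalizing F V with
  | output x => simp [OracleAlg.certifiedNonEdges, OracleAlg.queries]
  | query S next ih =>
    set w := bernoulliWeight p (powersetCard k (univ : Finset (Fin n))) with hw
    set P := powersetCard k S with hP
    set V₁ := V.filter (fun E => familyOracle E S = true) with hV₁
    set V₀ := V.filter (fun E => ¬ familyOracle E S = true) with hV₀
    have hPΩ : P ⊆ powersetCard k univ := powersetCard_mono (subset_univ S)
    have hwn : ∀ E, 0 ≤ w E := fun E => bernoulliWeight_nonneg hp0 hp1 _ E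
    have ih₁ := ih true (F ∪ P) V₁ ((filter_subset _ _).trans hV) (by
      intro E hE e he heF
      rw [mem_union, not_or] at heF
      rw [hV₁, mem_filter] at hE ⊢
      refine ⟨hins E hE.1 e he heF.1, ?_⟩
      have h2 := hE.2
      simp only [familyOracle, decide_eq_true_eq, mem_insert, forall_eq_or_imp] at h2 ⊢
      refine ⟨fun h => heF.2 ?_, h2⟩
      rw [hP, mem_powersetCard]
      exact ⟨h, (mem_powersetCard.1 he).2⟩)
    have ih₀ := ih false F V₀ ((filter_subset _ _).trans hV) (by
      intro E hE e he heF
      rw [hV₀, mem_filter] at hE ⊢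
      refine ⟨hins E hE.1 e he heF, fun h => hE.2 ?_⟩
      simp only [familyOracle, decide_eq_true_eq, mem_insert, forall_eq_or_imp] at h ⊢
      exact h.2)
    have hgain : ∑ E ∈ V₁, w E * ((#(coveredSets r (F ∪ P)) : ℝ) - #(coveredSets r F))
        ≤ ∑ E ∈ V, w E * q S := by
      have hsub : V₁ ⊆ V.filter (Disjoint (P \ F) ·) := by
        intro E hE
        rw [hV₁, mem_filter] at hE
        rw [mem_filter]
        refine ⟨hE.1, disjoint_left.2 fun e he heE => ?_⟩
        have h2 := hE.2
        simp only [familyOracle, decide_eq_true_eq] at h2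
        exact h2 e heE (mem_powersetCard.1 (mem_sdiff.1 he).1).1
      have h1 : ∑ E ∈ V₁, w E ≤ (1 - p) ^ #(P \ F) * ∑ E ∈ V, w E :=
        (sum_le_sum_of_subset_of_nonneg hsub fun E _ _ => hwn E).trans
          (sum_bernoulliWeight_disjoint_le hp0 hp1 hV (P \ F) (sdiff_subset.trans hPΩ)
            fun E hE e he => hins E hE e (hPΩ (mem_sdiff.1 he).1) (mem_sdiff.1 he).2)
      have h2 : (0 : ℝ) ≤ (#(coveredSets r (F ∪ P)) : ℝ) - #(coveredSets r F) := by
        rw [sub_nonneg, Nat.cast_le]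
        exact card_le_card (coveredSets_mono r subset_union_left)
      rw [← sum_mul, ← sum_mul]
      calc _ ≤ _ := mul_le_mul_of_nonneg_right h1 h2
        _ = (∑ E ∈ V, w E) * ((1 - p) ^ #(P \ F) *
            ((#(coveredSets r (F ∪ P)) : ℝ) - #(coveredSets r F))) := by ring
        _ ≤ _ := mul_le_mul_of_nonneg_left (hstep S F) (sum_nonneg fun E _ => hwn E)
    have hl₁ : ∑ E ∈ V₁, w E *
        ((#(coveredSets r (F ∪ (OracleAlg.query S next).certifiedNonEdges k (familyOracle E))) : ℝ)
          - #(coveredSets r F))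
        = ∑ E ∈ V₁, w E * ((#(coveredSets r (F ∪ P ∪
              (next true).certifiedNonEdges k (familyOracle E))) : ℝ)
            - #(coveredSets r (F ∪ P)))
          + ∑ E ∈ V₁, w E * ((#(coveredSets r (F ∪ P)) : ℝ) - #(coveredSets r F)) := by
      rw [← sum_add_distrib]
      refine sum_congr rfl fun E hE => ?_
      rw [OracleAlg.certifiedNonEdges, (mem_filter.1 hE).2, if_pos rfl, ← union_assoc]
      ring
    have hl₀ : ∑ E ∈ V₀, w E *
        ((#(coveredSets r (F ∪ (OracleAlg.query S next).certifiedNonEdges k (familyOracle E))) : ℝ)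
          - #(coveredSets r F))
        = ∑ E ∈ V₀, w E * ((#(coveredSets r (F ∪
              (next false).certifiedNonEdges k (familyOracle E))) : ℝ)
            - #(coveredSets r F)) := by
      refine sum_congr rfl fun E hE => ?_
      rw [OracleAlg.certifiedNonEdges, Bool.eq_false_of_not_eq_true (mem_filter.1 hE).2,
        if_neg Bool.false_ne_true, empty_union]
    have hr₁ : ∑ E ∈ V₁, w E * (((next (familyOracle E S)).queries (familyOracle E)).map q).sum
        = ∑ E ∈ V₁, w E * (((next true).queries (familyOracle E)).map q).sum :=
      sum_congr rfl fun E hE => by rw [(mem_filter.1 hE).2]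
    have hr₀ : ∑ E ∈ V₀, w E * (((next (familyOracle E S)).queries (familyOracle E)).map q).sum
        = ∑ E ∈ V₀, w E * (((next false).queries (familyOracle E)).map q).sum :=
      sum_congr rfl fun E hE => by rw [Bool.eq_false_of_not_eq_true (mem_filter.1 hE).2]
    have hr : ∑ E ∈ V, w E * (((OracleAlg.query S next).queries (familyOracle E)).map q).sum
        = ∑ E ∈ V, w E * q S
          + ∑ E ∈ V, w E * (((next (familyOracle E S)).queries (familyOracle E)).map q).sum := by
      rw [← sum_add_distrib]
      refine sum_congr rfl fun E _ => ?_
      rw [OracleAlg.queries, List.map_cons, List.sum_cons, mul_add]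
    rw [hr, ← sum_filter_add_sum_filter_not V (fun E => familyOracle E S = true),
      ← sum_filter_add_sum_filter_not V (fun E => familyOracle E S = true)
        (fun E => w E * (((next (familyOracle E S)).queries (familyOracle E)).map q).sum)]
    change _ + _ ≤ _ + (∑ E ∈ V₁, _ + ∑ E ∈ V₀, _)
    rw [hr₁, hr₀]
    change ∑ E ∈ V₁, _ + ∑ E ∈ V₀, _ ≤ _
    rw [hl₁, hl₀]
    linarith

/-- Two oracles lead to the same run unless they disagree on a query that is independent for the
first one; if the second oracle only differs by the planted edges through `R`, the `r`-set `R` is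
then covered by certified non-edges. -/
theorem OracleAlg.run_eq_of_notMem_coveredSets {k r : ℕ} {R : Finset (Fin n)} (hR : #R = r)
    {E E' : Finset (Finset (Fin n))} (hE : E ⊆ E')
    (hE' : ∀ e ∈ E', e ∉ E → R ⊆ e ∧ #e = k)
    (A : OracleAlg n) (hA : R ∉ coveredSets r (A.certifiedNonEdges k (familyOracle E))) :
    A.run (familyOracle E') = A.run (familyOracle E) := by
  induction A with
  | output x => rfl
  | query S next ih =>
    have hmono : coveredSets r ((next (familyOracle E S)).certifiedNonEdges k (familyOracle E)) ⊆
        coveredSets r ((OracleAlg.query S next).certifiedNonEdges k (familyOracle E)) :=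
      coveredSets_mono r subset_union_right
    have hS : familyOracle E' S = familyOracle E S := by
      cases hES : familyOracle E S with
      | false =>
        simp only [familyOracle, decide_eq_false_iff_not, not_forall] at hES ⊢
        obtain ⟨e, he, h⟩ := hES
        exact ⟨e, hE he, h⟩
      | true =>
        have hES' := hES
        simp only [familyOracle, decide_eq_true_eq] at hES' ⊢
        intro e he heS
        by_cases heE : e ∈ E
        · exact hES' e heE heS
        · obtain ⟨hRe, hek⟩ := hE' e he heE
          refine hA ?_
          rw [coveredSets, mem_filter, mem_powersetCard]
          refine ⟨⟨subset_univ R, hR⟩, e, ?_, hRe⟩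
          rw [OracleAlg.certifiedNonEdges, hES, if_pos rfl, mem_union, mem_powersetCard]
          exact Or.inl ⟨heS, hek⟩
    rw [OracleAlg.run, OracleAlg.run, hS]
    exact ih _ fun h => hA (hmono h)

/-- A new `r`-set in `S` is contained in no `k`-set of `F`, so every `k`-set between it and `S` is
new as well. -/
theorem card_new_covered_mul_le {k r : ℕ} (hrk : r ≤ k) (S : Finset (Fin n))
    (F : Finset (Finset (Fin n))) :
    #(coveredSets r (F ∪ powersetCard k S) \ coveredSets r F) * (#S - r).choose (k - r)
      ≤ #(powersetCard k S \ F) * k.choose r := by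
  refine card_mul_le_card_mul (fun R e : Finset (Fin n) => R ⊆ e) ?_ ?_
  · intro R hR
    rw [mem_sdiff, coveredSets, coveredSets, mem_filter, mem_filter, mem_powersetCard] at hR
    obtain ⟨⟨⟨-, hRr⟩, e, he, hRe⟩, hRF⟩ := hR
    have hnot : ∀ f ∈ F, ¬ R ⊆ f := fun f hf hRf =>
      hRF ⟨⟨subset_univ R, hRr⟩, f, hf, hRf⟩
    have heS : e ⊆ S := by
      rcases mem_union.1 he with he | he
      · exact absurd hRe (hnot e he)
      · exact (mem_powersetCard.1 he).1
    have hcount := card_powersetCard_filter_subset (hRe.trans heS) (hRr.le.trans hrk)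
    rw [hRr] at hcount
    rw [← hcount]
    refine card_le_card fun f hf => ?_
    rw [mem_filter] at hf
    rw [mem_bipartiteAbove, mem_sdiff]
    exact ⟨⟨hf.1, fun hfF => hnot f hfF hf.2⟩, hf.2⟩
  · intro e he
    have hek := (mem_powersetCard.1 (mem_sdiff.1 he).1).2
    rw [← hek, ← card_powersetCard]
    refine card_le_card fun R hR => ?_
    rw [mem_bipartiteBelow, mem_sdiff, coveredSets, mem_filter, mem_powersetCard] at hR
    exact mem_powersetCard.2 ⟨hR.2, hR.1.1.1.2⟩

theorem card_new_covered_le_choose {k r : ℕ} (S : Finset (Fin n)) (F : Finset (Finset (Fin n))) :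
    #(coveredSets r (F ∪ powersetCard k S) \ coveredSets r F) ≤ (#S).choose r := by
  rw [← card_powersetCard]
  refine card_le_card fun R hR => ?_
  rw [mem_sdiff, coveredSets, coveredSets, mem_filter, mem_filter, mem_powersetCard] at hR
  obtain ⟨⟨hR, e, he, hRe⟩, hRF⟩ := hR
  rcases mem_union.1 he with he | he
  · exact absurd ⟨hR, e, he, hRe⟩ hRF
  · exact mem_powersetCard.2 ⟨hRe.trans (mem_powersetCard.1 he).1, hR.2⟩

theorem one_sub_pow_mul_le_one {p : ℝ} (hp0 : 0 ≤ p) (hp1 : p ≤ 1) (m : ℕ) :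
    (1 - p) ^ m * (p * m) ≤ 1 := by
  have h1 : 1 + (m : ℝ) * p ≤ (1 + p) ^ m := one_add_mul_le_pow (by linarith) m
  have h2 : 0 ≤ (1 - p) ^ m := pow_nonneg (by linarith) m
  calc (1 - p) ^ m * (p * m) ≤ (1 - p) ^ m * (1 + p) ^ m :=
        mul_le_mul_of_nonneg_left (by linarith) h2
    _ = (1 - p ^ 2) ^ m := by rw [← mul_pow]; ring
    _ ≤ 1 := pow_le_one₀ (by nlinarith) (by nlinarith)

end Search

/-! ### The gain of a query against its cost -/

section Charge

/-- The gain `Z` of a query of size `s` is bounded in two ways, one useful for small `s` and one for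
large `s`. Together they bound it by a multiple of the cost `s ^ α`; the hypothesis `α ≤ r` makes
the first bound weakest, relative to the cost, at the largest small `s`. -/
theorem le_charge_of_two_bounds {n s k r : ℕ} {α M Z : ℝ} (hn : 1 ≤ n) (hs : 1 ≤ s) (hk : 1 ≤ k)
    (hrk : r ≤ k) (hα0 : 0 ≤ α) (hαr : α ≤ r) (hM : 0 ≤ M)
    (h₁ : Z * (n : ℝ) ^ r ≤ M * (s : ℝ) ^ r)
    (h₂ : Z * (s : ℝ) ^ (k - r) ≤ 8 * M * (k : ℝ) ^ k) :
    Z ≤ M * (8 * (k : ℝ) ^ k / (n : ℝ) ^ ((r : ℝ) * (k - r + α) / k)) * (s : ℝ) ^ α := by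
  have hn0 : (0 : ℝ) < n := by exact_mod_cast hn
  have hs0 : (0 : ℝ) < s := by exact_mod_cast hs
  have hk0 : (0 : ℝ) < k := by exact_mod_cast hk
  have hrk' : (r : ℝ) ≤ k := by exact_mod_cast hrk
  have hkk : (1 : ℝ) ≤ (k : ℝ) ^ k := one_le_pow₀ (by exact_mod_cast hk)
  set X : ℝ := (n : ℝ) ^ ((r : ℝ) * (k - r + α) / k) with hX
  have hX0 : 0 < X := Real.rpow_pos_of_pos hn0 _
  have hsα : 0 < (s : ℝ) ^ α := Real.rpow_pos_of_pos hs0 _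
  -- The two bounds on the gain cross at `s = n ^ (r / k)`.
  rcases le_total (s : ℝ) ((n : ℝ) ^ ((r : ℝ) / k)) with hsy | hsy
  · have hpow : (s : ℝ) ^ ((r : ℝ) - α) ≤ (n : ℝ) ^ ((r : ℝ) / k * (r - α)) := by
      rw [Real.rpow_mul hn0.le]
      exact Real.rpow_le_rpow hs0.le hsy (by linarith)
    have hsplit : (s : ℝ) ^ r = (s : ℝ) ^ α * (s : ℝ) ^ ((r : ℝ) - α) := by
      rw [← Real.rpow_add hs0, ← Real.rpow_natCast]
      congr 1; ring
    have hnsplit : (n : ℝ) ^ r = X * (n : ℝ) ^ ((r : ℝ) / k * (r - α)) := by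
      rw [hX, ← Real.rpow_add hn0, ← Real.rpow_natCast]
      congr 1; field_simp; ring
    set Y : ℝ := (n : ℝ) ^ ((r : ℝ) / k * (r - α)) with hY
    have hY0 : 0 < Y := Real.rpow_pos_of_pos hn0 _
    have h3 : Z * X ≤ M * (s : ℝ) ^ α := by
      refine le_of_mul_le_mul_right ?_ hY0
      calc Z * X * Y = Z * (n : ℝ) ^ r := by rw [hnsplit]; ring
        _ ≤ M * (s : ℝ) ^ r := h₁
        _ = M * (s : ℝ) ^ α * (s : ℝ) ^ ((r : ℝ) - α) := by rw [hsplit]; ring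
        _ ≤ _ := mul_le_mul_of_nonneg_left hpow (by positivity)
    have h4 : M * (8 * (k : ℝ) ^ k / X) * (s : ℝ) ^ α
        = (8 * (k : ℝ) ^ k) * (M * (s : ℝ) ^ α) / X := by ring
    rw [h4, le_div_iff₀ hX0]
    refine h3.trans (le_mul_of_one_le_left (by positivity) (by linarith))
  · have hpow : X ≤ (s : ℝ) ^ ((k : ℝ) - r + α) := by
      have : X = ((n : ℝ) ^ ((r : ℝ) / k)) ^ ((k : ℝ) - r + α) := by
        rw [← Real.rpow_mul hn0.le, hX]
        congr 1; ring
      rw [this]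
      exact Real.rpow_le_rpow (by positivity) hsy (by linarith)
    have hsplit : (s : ℝ) ^ ((k : ℝ) - r + α) = (s : ℝ) ^ (k - r) * (s : ℝ) ^ α := by
      rw [Real.rpow_add hs0, ← Real.rpow_natCast, Nat.cast_sub hrk]
    have h4 : M * (8 * (k : ℝ) ^ k / X) * (s : ℝ) ^ α
        = (8 * M * (k : ℝ) ^ k) * (s : ℝ) ^ α / X := by ring
    rw [h4, le_div_iff₀ hX0]
    rcases le_total Z 0 with hZ | hZ
    · exact (mul_nonpos_of_nonpos_of_nonneg hZ hX0.le).trans (by positivity)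
    calc Z * X ≤ Z * ((s : ℝ) ^ (k - r) * (s : ℝ) ^ α) := by
          rw [← hsplit]; exact mul_le_mul_of_nonneg_left hpow hZ
      _ = Z * (s : ℝ) ^ (k - r) * (s : ℝ) ^ α := by ring
      _ ≤ _ := mul_le_mul_of_nonneg_right h₂ hsα.le

/-- A query pays for its expected gain: sets with fewer than `k` vertices gain nothing, and for the
others both bounds of `le_charge_of_two_bounds` apply. -/
theorem expected_gain_le_charge {n k r : ℕ} {α : ℝ} (hn : 1 ≤ n) (hk : 1 ≤ k) (hkn : k ≤ n)
    (hrk : r ≤ k) (hα0 : 0 ≤ α) (hαr : α ≤ r) (S : Finset (Fin n)) (F : Finset (Finset (Fin n))) :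
    (1 - (k.choose r : ℝ) / (8 * n.choose r)) ^ #(powersetCard k S \ F) *
        ((#(coveredSets r (F ∪ powersetCard k S)) : ℝ) - #(coveredSets r F))
      ≤ (n.choose r : ℝ) * (8 * (k : ℝ) ^ k / (n : ℝ) ^ ((r : ℝ) * (k - r + α) / k))
        * queryCost α #S := by
  have hM0 : (0 : ℝ) < n.choose r := by exact_mod_cast Nat.choose_pos (hrk.trans hkn)
  have hckn : (k.choose r : ℝ) ≤ n.choose r := by exact_mod_cast Nat.choose_le_choose r hkn
  set p : ℝ := (k.choose r : ℝ) / (8 * n.choose r) with hp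
  have hp0 : 0 ≤ p := by positivity
  have hp1 : p ≤ 1 := by
    rw [hp, div_le_one (by positivity)]; linarith
  have hδ : ((#(coveredSets r (F ∪ powersetCard k S)) : ℝ) - #(coveredSets r F))
      = #(coveredSets r (F ∪ powersetCard k S) \ coveredSets r F) := by
    rw [card_sdiff_of_subset (coveredSets_mono r subset_union_left),
      Nat.cast_sub (card_le_card (coveredSets_mono r subset_union_left))]
  rcases lt_or_ge #S k with hSk | hkS
  · rw [powersetCard_eq_empty.2 hSk, union_empty, sub_self, mul_zero]
    have : 0 ≤ queryCost α #S := by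
      unfold queryCost; split_ifs <;> positivity
    positivity
  rw [hδ, queryCost, if_neg (by omega)]
  set X := (1 - p) ^ #(powersetCard k S \ F) with hX
  set δ := #(coveredSets r (F ∪ powersetCard k S) \ coveredSets r F) with hδ'
  have hX0 : 0 ≤ X := pow_nonneg (by linarith) _
  have hX1 : X ≤ 1 := pow_le_one₀ (by linarith) (by linarith)
  have hSn : #S ≤ n := (card_le_univ S).trans_eq (Fintype.card_fin n)
  refine le_charge_of_two_bounds hn (by omega) hk hrk hα0 hαr hM0.le ?_ ?_
  · have h1 : (δ : ℝ) * (n : ℝ) ^ r ≤ (n.choose r : ℝ) * (#S : ℝ) ^ r := by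
      exact_mod_cast (Nat.mul_le_mul_right _ (card_new_covered_le_choose S F)).trans
        (choose_mul_pow_le hSn r)
    calc X * δ * (n : ℝ) ^ r = X * (δ * (n : ℝ) ^ r) := by ring
      _ ≤ 1 * (δ * (n : ℝ) ^ r) := mul_le_mul_of_nonneg_right hX1 (by positivity)
      _ ≤ _ := by rw [one_mul]; exact h1
  · have h1 : (δ : ℝ) * ((#S - r).choose (k - r) : ℕ)
        ≤ #(powersetCard k S \ F) * (k.choose r : ℕ) := by
      exact_mod_cast card_new_covered_mul_le hrk S F
    have h2 : (#S : ℝ) ^ (k - r) ≤ (k : ℝ) ^ (k - r) * ((#S - r).choose (k - r) : ℕ) := by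
      exact_mod_cast pow_le_pow_mul_choose_sub r hkS
    have h3 : X * (p * #(powersetCard k S \ F)) ≤ 1 := one_sub_pow_mul_le_one hp0 hp1 _
    have h4 : (k.choose r : ℝ) = p * (8 * n.choose r) := by
      rw [hp]; field_simp
    have h5 : (k : ℝ) ^ (k - r) ≤ (k : ℝ) ^ k :=
      pow_le_pow_right₀ (by exact_mod_cast hk) (Nat.sub_le k r)
    calc X * δ * (#S : ℝ) ^ (k - r)
        ≤ X * δ * ((k : ℝ) ^ (k - r) * ((#S - r).choose (k - r) : ℕ)) :=
          mul_le_mul_of_nonneg_left h2 (mul_nonneg hX0 (Nat.cast_nonneg _))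
      _ = X * (k : ℝ) ^ (k - r) * (δ * ((#S - r).choose (k - r) : ℕ)) := by ring
      _ ≤ X * (k : ℝ) ^ (k - r) * (#(powersetCard k S \ F) * (k.choose r : ℕ)) :=
          mul_le_mul_of_nonneg_left h1 (by positivity)
      _ = (X * (p * #(powersetCard k S \ F))) * (8 * n.choose r * (k : ℝ) ^ (k - r)) := by
          rw [h4]; ring
      _ ≤ 1 * (8 * n.choose r * (k : ℝ) ^ (k - r)) :=
          mul_le_mul_of_nonneg_right h3 (by positivity)
      _ ≤ _ := by rw [one_mul]; exact mul_le_mul_of_nonneg_left h5 (by positivity)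

end Charge

/-! ### Planted hypergraphs -/

section Planting

variable {n k : ℕ}

/-- The hypergraph whose edges are the `k`-sets in `E`. -/
def KHypergraph.ofFamily (k : ℕ) (E : Finset (Finset (Fin n))) : KHypergraph n k where
  edges := {e ∈ E | #e = k}
  uniform _ he := (mem_filter.1 he).2

/-- The family `E` together with all `k`-sets that contain `R`. -/
def plantedFamily (k : ℕ) (R : Finset (Fin n)) (E : Finset (Finset (Fin n))) :
    Finset (Finset (Fin n)) :=
  E ∪ {e ∈ powersetCard k (univ : Finset (Fin n)) | R ⊆ e}

theorem KHypergraph.edges_ofFamily {E : Finset (Finset (Fin n))} (hE : E ⊆ powersetCard k univ) :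
    (KHypergraph.ofFamily k E).edges = E :=
  filter_true_of_mem fun _ he => (mem_powersetCard.1 (hE he)).2

theorem KHypergraph.indOracle_ofFamily {E : Finset (Finset (Fin n))}
    (hE : E ⊆ powersetCard k univ) :
    (KHypergraph.ofFamily k E).indOracle = familyOracle E := by
  funext S
  rw [KHypergraph.indOracle, familyOracle, edges_ofFamily hE]

theorem plantedFamily_subset {R : Finset (Fin n)} {E : Finset (Finset (Fin n))}
    (hE : E ⊆ powersetCard k univ) : plantedFamily k R E ⊆ powersetCard k univ :=
  union_subset hE (filter_subset _ _)

theorem choose_le_card_plantedFamily {R : Finset (Fin n)} (hR : #R ≤ k)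
    (E : Finset (Finset (Fin n))) :
    (n - #R).choose (k - #R) ≤ #(plantedFamily k R E) := by
  have h := card_powersetCard_filter_subset (subset_univ R) hR
  rw [card_univ, Fintype.card_fin] at h
  rw [← h]
  exact card_le_card subset_union_right

theorem not_isApproximation_half_of_four_mul_le {x a b : ℝ} (hb : 0 < b) (hab : 4 * a ≤ b)
    (ha : IsApproximation (1 / 2) x a) : ¬ IsApproximation (1 / 2) x b := by
  intro h
  unfold IsApproximation at ha h
  rw [abs_le] at ha h
  linarith [ha.2, h.1]

/-- An algorithm that approximates the number of edges both of a sparse hypergraph and of its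
planted version has to tell the two apart, hence covers the planted set. -/
theorem OracleAlg.mem_coveredSets_of_isApproximation {r : ℕ} (hrk : r ≤ k) (hkn : k ≤ n)
    {R : Finset (Fin n)} (hR : #R = r) {E : Finset (Finset (Fin n))}
    (hsparse : 4 * (#E : ℝ) ≤ (n - r).choose (k - r))
    (A : OracleAlg n)
    (h₁ : IsApproximation (1 / 2) (A.run (familyOracle E)) #E)
    (h₂ : IsApproximation (1 / 2) (A.run (familyOracle (plantedFamily k R E)))
      #(plantedFamily k R E)) :
    R ∈ coveredSets r (A.certifiedNonEdges k (familyOracle E)) := by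
  by_contra hcov
  have hrun := A.run_eq_of_notMem_coveredSets hR (E' := plantedFamily k R E) subset_union_left
    (by
      intro e he heE
      rcases mem_union.1 he with he | he
      · exact absurd he heE
      · rw [mem_filter, mem_powersetCard] at he
        exact ⟨he.2, he.1.2⟩) hcov
  rw [hrun] at h₂
  have hcard : ((n - r).choose (k - r) : ℝ) ≤ #(plantedFamily k R E) := by
    have := choose_le_card_plantedFamily (hR.le.trans hrk) E
    rw [hR] at this
    exact_mod_cast this
  have hpos : (0 : ℝ) < (n - r).choose (k - r) := by
    exact_mod_cast Nat.choose_pos (Nat.sub_le_sub_right hkn r)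
  exact not_isApproximation_half_of_four_mul_le (hpos.trans_le hcard) (hsparse.trans hcard) h₁ h₂

theorem PMF.four_fifths_le_tsum_of_inter_subset {β : Type*} (P : PMF β) {s t u : Set β}
    (hs : (9 / 10 : ENNReal) ≤ P.toOuterMeasure s) (ht : (9 / 10 : ENNReal) ≤ P.toOuterMeasure t)
    (hu : s ∩ t ⊆ u) : (4 / 5 : ENNReal) ≤ ∑' a, P a * u.indicator 1 a := by
  classical
  have hsum : P.toOuterMeasure s + P.toOuterMeasure t ≤ 1 + ∑' a, P a * u.indicator 1 a := by
    rw [PMF.toOuterMeasure_apply, PMF.toOuterMeasure_apply, ← ENNReal.tsum_add, ← P.tsum_coe,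
      ← ENNReal.tsum_add]
    refine ENNReal.tsum_le_tsum fun a => ?_
    by_cases has : a ∈ s <;> by_cases hat : a ∈ t
    · simp [has, hat, hu ⟨has, hat⟩]
    all_goals simp [has, hat]
  have h2 : (1 : ENNReal) + 4 / 5 ≤ 1 + ∑' a, P a * u.indicator 1 a := by
    refine le_trans (le_of_eq ?_) ((add_le_add hs ht).trans hsum)
    rw [← ENNReal.toReal_eq_toReal_iff' (by finiteness) (by finiteness),
      ENNReal.toReal_add (by finiteness) (by finiteness),
      ENNReal.toReal_add (by finiteness) (by finiteness)]
    norm_num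
  exact (ENNReal.add_le_add_iff_left ENNReal.one_ne_top).1 h2

end Planting

/-! ### The lower bound for randomised algorithms -/

section LowerBound

variable {n k r : ℕ}

theorem coveredSets_empty (r : ℕ) : coveredSets r (∅ : Finset (Finset (Fin n))) = ∅ := by
  simp [coveredSets]

theorem queryCost_nonneg (β : ℝ) (x : ℕ) : 0 ≤ queryCost β x := by
  unfold queryCost; split_ifs <;> positivity

theorem OracleAlg.cost_nonneg (β : ℝ) (A : OracleAlg n) (G : KHypergraph n k) :
    0 ≤ A.cost β G := by
  refine List.sum_nonneg fun x hx => ?_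
  obtain ⟨S, -, rfl⟩ := List.mem_map.1 hx
  exact queryCost_nonneg β _

/-- For every deterministic algorithm, the expected number of covered `r`-sets on the random
hypergraph is bounded by a multiple of the expected cost. -/
theorem sum_covered_le_mul_sum_cost {α : ℝ} (hn : 1 ≤ n) (hk : 1 ≤ k) (hkn : k ≤ n) (hrk : r ≤ k)
    (hα0 : 0 ≤ α) (hαr : α ≤ r) (A : OracleAlg n) :
    ∑ E ∈ (powersetCard k (univ : Finset (Fin n))).powerset,
        bernoulliWeight ((k.choose r : ℝ) / (8 * n.choose r)) (powersetCard k univ) E *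
          #(coveredSets r (A.certifiedNonEdges k (familyOracle E)))
      ≤ (n.choose r : ℝ) * (8 * (k : ℝ) ^ k / (n : ℝ) ^ ((r : ℝ) * (k - r + α) / k)) *
        ∑ E ∈ (powersetCard k (univ : Finset (Fin n))).powerset,
          bernoulliWeight ((k.choose r : ℝ) / (8 * n.choose r)) (powersetCard k univ) E *
            A.cost α (KHypergraph.ofFamily k E) := by
  have hM0 : (0 : ℝ) < n.choose r := by exact_mod_cast Nat.choose_pos (hrk.trans hkn)
  have hckn : (k.choose r : ℝ) ≤ n.choose r := by exact_mod_cast Nat.choose_le_choose r hkn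
  have hp1 : (k.choose r : ℝ) / (8 * n.choose r) ≤ 1 := by
    rw [div_le_one (by positivity)]; linarith
  have h := sum_covered_le_sum_charge (k := k) (r := r) (by positivity) hp1 _
    (expected_gain_le_charge (α := α) hn hk hkn hrk hα0 hαr) A ∅
    (powersetCard k univ).powerset Subset.rfl
    (fun E hE e he _ => mem_powerset.2 (insert_subset he (mem_powerset.1 hE)))
  simp only [empty_union, coveredSets_empty, card_empty, Nat.cast_zero, sub_zero] at h
  refine h.trans (le_of_eq ?_)
  rw [mul_sum]
  refine sum_congr rfl fun E hE => ?_
  rw [OracleAlg.cost, KHypergraph.indOracle_ofFamily (mem_powerset.1 hE), List.sum_map_mul_left]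
  ring

/-- On a sparse hypergraph, an accurate randomised algorithm covers in expectation at least four
fifths of all `r`-sets, since each of them might be the planted one. -/
theorem four_fifths_mul_le_tsum_covered (hrk : r ≤ k) (hkn : k ≤ n) (𝒜 : RandomisedOracleAlg n)
    (h𝒜 : ∀ G : KHypergraph n k, (9 / 10 : ENNReal) ≤ 𝒜.successProb (1 / 2) G)
    {E : Finset (Finset (Fin n))} (hE : E ⊆ powersetCard k univ)
    (hsparse : 4 * (#E : ℝ) ≤ (n - r).choose (k - r)) :
    (n.choose r : ENNReal) * (4 / 5) ≤
      ∑' A, 𝒜 A * (#(coveredSets r (A.certifiedNonEdges k (familyOracle E))) : ENNReal) := by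
  have hcount : ∀ A : OracleAlg n,
      (#(coveredSets r (A.certifiedNonEdges k (familyOracle E))) : ENNReal)
      = ∑ R ∈ powersetCard r (univ : Finset (Fin n)),
        {A : OracleAlg n | R ∈ coveredSets r (A.certifiedNonEdges k (familyOracle E))}.indicator
          (1 : OracleAlg n → ENNReal) A := by
    intro A
    have hsub : coveredSets r (A.certifiedNonEdges k (familyOracle E))
        ⊆ powersetCard r (univ : Finset (Fin n)) := filter_subset _ _
    simp only [Set.indicator_apply, Set.mem_ofPred_eq, Pi.one_apply]
    rw [← sum_filter, sum_const, nsmul_eq_mul, mul_one, filter_mem_eq_inter,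
      inter_eq_right.2 hsub]
  simp only [hcount, mul_sum]
  rw [Summable.tsum_finsetSum fun _ _ => ENNReal.summable]
  have hR : ∀ R ∈ powersetCard r (univ : Finset (Fin n)), (4 / 5 : ENNReal) ≤
      ∑' A, 𝒜 A *
        {A : OracleAlg n | R ∈ coveredSets r (A.certifiedNonEdges k (familyOracle E))}.indicator
          (1 : OracleAlg n → ENNReal) A := by
    intro R hR
    have hP : plantedFamily k R E ⊆ powersetCard k univ := plantedFamily_subset hE
    refine PMF.four_fifths_le_tsum_of_inter_subset 𝒜 (h𝒜 (KHypergraph.ofFamily k E))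
      (h𝒜 (KHypergraph.ofFamily k (plantedFamily k R E))) ?_
    rintro A ⟨h₁, h₂⟩
    rw [Set.mem_ofPred_eq, KHypergraph.edgeCount, KHypergraph.indOracle_ofFamily hE,
      KHypergraph.edges_ofFamily hE] at h₁
    rw [Set.mem_ofPred_eq, KHypergraph.edgeCount, KHypergraph.indOracle_ofFamily hP,
      KHypergraph.edges_ofFamily hP] at h₂
    exact A.mem_coveredSets_of_isApproximation hrk hkn (mem_powersetCard.1 hR).2 hsparse h₁ h₂
  calc (n.choose r : ENNReal) * (4 / 5)
      = ∑ _R ∈ powersetCard r (univ : Finset (Fin n)), (4 / 5 : ENNReal) := by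
        rw [sum_const, card_powersetCard, card_univ, Fintype.card_fin, nsmul_eq_mul]
    _ ≤ _ := sum_le_sum hR

/-- The expected number of covered `r`-sets, averaged over the random hypergraph and over the
algorithm, is bounded from below by accuracy and from above by the worst-case cost. -/
theorem worstCaseExpectedCost_lower_bound {α : ℝ} (hn : 1 ≤ n) (hk : 1 ≤ k) (hkn : k ≤ n)
    (hrk : r ≤ k) (hα0 : 0 ≤ α) (hαr : α ≤ r) (𝒜 : RandomisedOracleAlg n)
    (h𝒜 : ∀ G : KHypergraph n k, (9 / 10 : ENNReal) ≤ 𝒜.successProb (1 / 2) G) :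
    ENNReal.ofReal (1 / 20 * ((n : ℝ) ^ ((r : ℝ) * (k - r + α) / k) / (k : ℝ) ^ k))
      ≤ 𝒜.worstCaseExpectedCost k α := by
  have hM0 : (0 : ℝ) < n.choose r := by exact_mod_cast Nat.choose_pos (hrk.trans hkn)
  have hK0 : (0 : ℝ) < (n - r).choose (k - r) := by
    exact_mod_cast Nat.choose_pos (Nat.sub_le_sub_right hkn r)
  have hckn : (k.choose r : ℝ) ≤ n.choose r := by exact_mod_cast Nat.choose_le_choose r hkn
  have hn0 : (0 : ℝ) < n := by exact_mod_cast hn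
  have hk0 : (0 : ℝ) < k := by exact_mod_cast hk
  have hX0 : 0 < (n : ℝ) ^ ((r : ℝ) * (k - r + α) / k) := Real.rpow_pos_of_pos hn0 _
  have hmain := sum_covered_le_mul_sum_cost (r := r) (α := α) hn hk hkn hrk hα0 hαr
  set p : ℝ := (k.choose r : ℝ) / (8 * n.choose r) with hp
  set Ω := powersetCard k (univ : Finset (Fin n)) with hΩ
  set X : ℝ := (n : ℝ) ^ ((r : ℝ) * (k - r + α) / k) with hX
  set C : ℝ := n.choose r * (8 * (k : ℝ) ^ k / X) with hC
  have hC0 : 0 < C := by positivity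
  have hp0 : 0 ≤ p := by positivity
  have hp1 : p ≤ 1 := by
    rw [hp, div_le_one (by positivity)]; linarith
  have hwn : ∀ E, 0 ≤ bernoulliWeight p Ω E := fun E => bernoulliWeight_nonneg hp0 hp1 Ω E
  -- The expected number of random edges is one eighth of the number of planted edges.
  have hmean : 8 * (p * (#Ω : ℝ)) ≤ (n - r).choose (k - r) := by
    have h : (n.choose k : ℝ) * k.choose r = n.choose r * (n - r).choose (k - r) := by
      exact_mod_cast Nat.choose_mul (n := n) hrk
    rw [hΩ, card_powersetCard, card_univ, Fintype.card_fin, hp]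
    refine le_of_eq ?_
    field_simp
    linarith
  have hgood := half_le_sum_bernoulliWeight_card_le hp0 hp1 hK0 Ω hmean
  have hupper : ∑' A, 𝒜 A * ∑ E ∈ Ω.powerset, ENNReal.ofReal (bernoulliWeight p Ω E) *
        (#(coveredSets r (A.certifiedNonEdges k (familyOracle E))) : ENNReal)
      ≤ ENNReal.ofReal C * 𝒜.worstCaseExpectedCost k α := by
    calc _ ≤ ∑' A, 𝒜 A * (ENNReal.ofReal C * ∑ E ∈ Ω.powerset,
          ENNReal.ofReal (bernoulliWeight p Ω E) *
            ENNReal.ofReal (A.cost α (KHypergraph.ofFamily k E))) := by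
          refine ENNReal.tsum_le_tsum fun A => mul_le_mul_right ?_ _
          have h := ENNReal.ofReal_le_ofReal (hmain A)
          rw [ENNReal.ofReal_mul hC0.le,
            ENNReal.ofReal_sum_of_nonneg fun E _ => mul_nonneg (hwn E) (Nat.cast_nonneg _),
            ENNReal.ofReal_sum_of_nonneg fun E _ => mul_nonneg (hwn E) (A.cost_nonneg α _)] at h
          simpa only [ENNReal.ofReal_mul (hwn _), ENNReal.ofReal_natCast] using h
      _ = ENNReal.ofReal C * ∑ E ∈ Ω.powerset, ENNReal.ofReal (bernoulliWeight p Ω E) *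
            𝒜.expectedCost α (KHypergraph.ofFamily k E) := by
          simp only [RandomisedOracleAlg.expectedCost, ← ENNReal.tsum_mul_left]
          rw [← Summable.tsum_finsetSum fun _ _ => ENNReal.summable, ← ENNReal.tsum_mul_left]
          refine tsum_congr fun A => ?_
          rw [mul_left_comm, mul_sum]
          congr 1
          refine sum_congr rfl fun E _ => ?_
          rw [mul_left_comm]
      _ ≤ ENNReal.ofReal C * ∑ E ∈ Ω.powerset, ENNReal.ofReal (bernoulliWeight p Ω E) *
            𝒜.worstCaseExpectedCost k α := by
          refine mul_le_mul_right (sum_le_sum fun E _ => mul_le_mul_right ?_ _) _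
          exact le_iSup (fun G : KHypergraph n k => 𝒜.expectedCost α G) _
      _ = _ := by
          rw [← sum_mul, ← ENNReal.ofReal_sum_of_nonneg fun E _ => hwn E, sum_bernoulliWeight,
            ENNReal.ofReal_one, one_mul]
  have hlower : ENNReal.ofReal (2 / 5 * n.choose r) ≤
      ∑' A, 𝒜 A * ∑ E ∈ Ω.powerset, ENNReal.ofReal (bernoulliWeight p Ω E) *
        (#(coveredSets r (A.certifiedNonEdges k (familyOracle E))) : ENNReal) := by
    calc _ ≤ ENNReal.ofReal (∑ E ∈ Ω.powerset with 4 * (#E : ℝ) ≤ (n - r).choose (k - r),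
            bernoulliWeight p Ω E) * ((n.choose r : ENNReal) * (4 / 5)) := by
          have h45 : (n.choose r : ENNReal) * (4 / 5)
              = ENNReal.ofReal (n.choose r * (4 / 5)) := by
            rw [ENNReal.ofReal_mul (by positivity), ENNReal.ofReal_natCast,
              ENNReal.ofReal_div_of_pos (by norm_num), ENNReal.ofReal_ofNat,
              ENNReal.ofReal_ofNat]
          rw [h45, ← ENNReal.ofReal_mul (by linarith)]
          refine ENNReal.ofReal_le_ofReal ?_
          nlinarith
      _ ≤ ∑ E ∈ Ω.powerset with 4 * (#E : ℝ) ≤ (n - r).choose (k - r),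
            ENNReal.ofReal (bernoulliWeight p Ω E) *
            ∑' A, 𝒜 A *
              (#(coveredSets r (A.certifiedNonEdges k (familyOracle E))) : ENNReal) := by
          rw [ENNReal.ofReal_sum_of_nonneg fun E _ => hwn E, sum_mul]
          refine sum_le_sum fun E hE => mul_le_mul_right ?_ _
          rw [mem_filter, mem_powerset] at hE
          exact four_fifths_mul_le_tsum_covered hrk hkn 𝒜 h𝒜 hE.1 hE.2
      _ ≤ ∑ E ∈ Ω.powerset, ENNReal.ofReal (bernoulliWeight p Ω E) *
            ∑' A, 𝒜 A *
              (#(coveredSets r (A.certifiedNonEdges k (familyOracle E))) : ENNReal) :=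
          sum_le_sum_of_subset (filter_subset _ _)
      _ = _ := by
          simp only [← ENNReal.tsum_mul_left]
          rw [← Summable.tsum_finsetSum fun _ _ => ENNReal.summable]
          refine tsum_congr fun A => ?_
          rw [mul_sum]
          refine sum_congr rfl fun E _ => ?_
          rw [mul_left_comm]
  have hfinal := hlower.trans hupper
  have hsplit : 2 / 5 * (n.choose r : ℝ) = C * (1 / 20 * (X / (k : ℝ) ^ k)) := by
    rw [hC]; field_simp; norm_num
  rw [hsplit, ENNReal.ofReal_mul hC0.le] at hfinal
  exact (ENNReal.mul_le_mul_iff_right (ENNReal.ofReal_pos.2 hC0).ne' ENNReal.ofReal_ne_top).1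
    hfinal

/-- The choice `r = k - ⌊(k - α) / 2⌉` of the size of the planted set is admissible. -/
theorem exists_nat_roundHalfUp_eq_sub {k : ℕ} {α : ℝ} (hk : 1 ≤ k) (hα0 : 0 ≤ α) (hαk : α ≤ k) :
    ∃ r : ℕ, r ≤ k ∧ α ≤ r ∧ (roundHalfUp (((k : ℝ) - α) / 2) : ℝ) = k - r := by
  set z : ℤ := roundHalfUp (((k : ℝ) - α) / 2) with hz
  have hk1 : (1 : ℝ) ≤ k := by exact_mod_cast hk
  have hle : (z : ℝ) ≤ ((k : ℝ) - α) / 2 + 1 / 2 := Int.floor_le _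
  have hz0 : 0 ≤ z := Int.floor_nonneg.2 (by linarith)
  have hzα : (z : ℝ) ≤ k - α := by
    rcases le_or_gt z 0 with h | h
    · have : (z : ℝ) ≤ 0 := by exact_mod_cast h
      linarith
    · have : (1 : ℝ) ≤ z := by exact_mod_cast h
      linarith
  lift z to ℕ using hz0 with m
  rw [Int.cast_natCast] at hzα
  have hmk : m ≤ k := by
    have : (m : ℝ) ≤ k := by linarith
    exact_mod_cast this
  refine ⟨k - m, Nat.sub_le k m, ?_, ?_⟩
  · rw [Nat.cast_sub hmk]; linarith
  · rw [Nat.cast_sub hmk, Int.cast_natCast]; ring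

end LowerBound

theorem theorem3p16 :
    ∃ c : ℝ, 0 < c ∧ ∃ n₀ : ℕ, ∀ n : ℕ, n₀ ≤ n → ∀ k : ℕ, 2 ≤ k → k ≤ n →
      ∀ α : ℝ, 0 ≤ α → α ≤ (k : ℝ) →
      ∀ 𝒜 : RandomisedOracleAlg n,
        (∀ G : KHypergraph n k, (9 / 10 : ENNReal) ≤ 𝒜.successProb (1 / 2) G) →
        ENNReal.ofReal (c * ((n : ℝ) ^ (α + overheadExponent (k : ℝ) α) / (k : ℝ) ^ (3 * k)))
          ≤ 𝒜.worstCaseExpectedCost k α := by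
  refine ⟨1 / 20, by norm_num, 0, fun n _ k hk hkn α hα0 hαk 𝒜 h𝒜 => ?_⟩
  obtain ⟨r, hrk, hαr, hr⟩ := exists_nat_roundHalfUp_eq_sub (by omega : 1 ≤ k) hα0 hαk
  refine le_trans (ENNReal.ofReal_le_ofReal ?_)
    (worstCaseExpectedCost_lower_bound (by omega) (by omega) hkn hrk hα0 hαr 𝒜 h𝒜)
  have hk0 : (1 : ℝ) ≤ k := by exact_mod_cast (by omega : 1 ≤ k)
  have hexp : α + overheadExponent (k : ℝ) α = (r : ℝ) * (k - r + α) / k := by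
    rw [overheadExponent, hr]
    field_simp
    ring
  have hpow : (k : ℝ) ^ k ≤ (k : ℝ) ^ (3 * k) := pow_le_pow_right₀ hk0 (by omega)
  rw [hexp]
  gcongr
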